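/- Let $(W,H,\mu)$ be an abstract Wiener space: $H$ is a separable real Hilbert space, $W$ is a real Banach or Fréchet space into which $H$ is continuously, linearly and injectively embedded with dense range, and $\mu$ is the Borel (Radon) probability measure on $W$ under which every $\varphi\in W^*$ has law $N(0,|\tilde\varphi|_H^2)$, where $\tilde\varphi\in H$ is defined by $(\tilde\varphi,h)_H=\varphi(h)$ for all $h\in H$. The map $\varphi\mapsto\tilde\varphi$ is the canonical injection $W^*\hookrightarrow H$. Let $F:W\to\mathbb R\cup\{\infty\}$ be a Wiener functional, i.e. a $\mu$-measurable function. With the convention $0\cdot\infty=0$: * $F$ is *$H$-convex* if for all $h,k\in H$ and $\alpha\in[0,1]$, $$F(w+\alpha h+(1-\alpha)k)\le \alpha F(w+h)+(1-\alpha)F(w+k)\quad\text{for $\mu$-almost all } w\in W,$$ where the exceptional null set may depend on $h,k,\alpha$. * $F$ is *$\mathcal C$-convex* if, for every family $(e_i)_{1\le i\le \dim H}$ (indexed by $\{1,2,\dots\}$ if $\dim H=\infty$) in $W^*$ whose image $(\tilde e_i)$ is a complete orthonormal basis of $H$, and every integer $0\le n\le\dim H$, the following holds with $w_n=\sum_{i=1}^n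 e_i(w)\,\tilde e_i$ and $w_n^\perp=w-w_n$: for $\mu$-almost all $w$, the map $$(x_1,\dots,x_n)\mapsto F\Bigl(w_n^\perp+\sum_{i=1}^n x_i\tilde e_i\Bigr)$$ on $\mathbb R^n\simeq\mathrm{span}\{\tilde e_1,\dots,\tilde e_n\}$ coincides Lebesgue-almost everywhere with a convex function $\mathbb R^n\to\mathbb R\cup\{\infty\}$. **Theorem.** $F$ is $H$-convex if and only if $F$ is $\mathcal C$-convex. -/

import Mathlib

open MeasureTheory ProbabilityTheory

namespace WienerConvexity

/-- The image `φ̃ ∈ H` of a continuous linear functional `φ` on `W` under the canonical injection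
`W* ↪ H` dual to `i : H → W` (with `H` identified with its dual): `⟪φ̃, h⟫ = φ (i h)`. -/
noncomputable def dualToH {H W : Type*} [NormedAddCommGroup H] [InnerProductSpace ℝ H]
    [CompleteSpace H] [AddCommGroup W] [Module ℝ W] [TopologicalSpace W]
    (i : H →L[ℝ] W) (φ : StrongDual ℝ W) : H :=
  (InnerProductSpace.toDual ℝ H).symm (φ.comp i)

/-- `(W, H, μ)`, with `H` embedded in `W` by `i`, is an abstract Wiener space: `i` is a continuous
linear injection with dense range and the probability measure `μ` on `W` is the standard
cylindrical Gaussian measure of `H`, i.e. under `μ` every `φ ∈ W*` has law `N(0, |φ̃|²)`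
(by linearity this fixes all joint laws). For a Fréchet space `W` and a separable `H` the space `W`
is Polish, so that `μ` is automatically a Radon measure. -/
structure IsAbstractWienerSpace {H W : Type*} [NormedAddCommGroup H] [InnerProductSpace ℝ H]
    [CompleteSpace H] [AddCommGroup W] [Module ℝ W] [TopologicalSpace W] [MeasurableSpace W]
    (i : H →L[ℝ] W) (μ : Measure W) : Prop where
  injective : Function.Injective i
  denseRange : DenseRange i
  isProbabilityMeasure : IsProbabilityMeasure μ
  map_eq_gaussianReal : ∀ φ : StrongDual ℝ W, μ.map φ = gaussianReal 0 (‖dualToH i φ‖₊ ^ 2)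

/-- Convexity of a function with values in `ℝ ∪ {∞}` (the value `-∞` is excluded), with the
convention `0 * ∞ = 0`. -/
def IsConvexFun {E : Type*} [AddCommGroup E] [Module ℝ E] (g : E → EReal) : Prop :=
  (∀ x, g x ≠ ⊥) ∧
    ∀ x y : E, ∀ α ∈ Set.Icc (0 : ℝ) 1,
      g (α • x + (1 - α) • y) ≤ (α : EReal) * g x + ((1 - α : ℝ) : EReal) * g y

/-- `H`-convexity; the exceptional set may depend on `h`, `k` and `α`. -/
def IsHConvex {H W : Type*} [NormedAddCommGroup H] [InnerProductSpace ℝ H]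
    [AddCommGroup W] [Module ℝ W] [TopologicalSpace W] [MeasurableSpace W]
    (i : H →L[ℝ] W) (μ : Measure W) (F : W → EReal) : Prop :=
  ∀ h k : H, ∀ α ∈ Set.Icc (0 : ℝ) 1, ∀ᵐ w ∂μ,
    F (w + α • i h + (1 - α) • i k)
      ≤ (α : EReal) * F (w + i h) + ((1 - α : ℝ) : EReal) * F (w + i k)

/-- `(e j)`, `j < N`, is a complete orthonormal basis of `H` contained in `W*`. If `H` is
infinite-dimensional then `N = ∞`, and the basis is indexed by `ℕ`; if `H` has finite dimension
then `N` is this dimension, and the values `e j` for `j ≥ N` are irrelevant. -/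
def IsBasisInDual {H W : Type*} [NormedAddCommGroup H] [InnerProductSpace ℝ H]
    [CompleteSpace H] [AddCommGroup W] [Module ℝ W] [TopologicalSpace W]
    (i : H →L[ℝ] W) (N : ℕ∞) (e : ℕ → StrongDual ℝ W) : Prop :=
  Orthonormal ℝ (fun j : {j : ℕ // (j : ℕ∞) < N} => dualToH i (e j)) ∧
    (Submodule.span ℝ
      (Set.range fun j : {j : ℕ // (j : ℕ∞) < N} => dualToH i (e j))).topologicalClosure = ⊤

/-- The point `∑ j < n, x j • e_j` of `span {e_0, …, e_{n-1}} ⊆ H ⊆ W` with coordinates `x`. -/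
noncomputable def spanPoint {H W : Type*} [NormedAddCommGroup H] [InnerProductSpace ℝ H]
    [CompleteSpace H] [AddCommGroup W] [Module ℝ W] [TopologicalSpace W]
    (i : H →L[ℝ] W) (e : ℕ → StrongDual ℝ W) (n : ℕ) (x : Fin n → ℝ) : W :=
  ∑ j : Fin n, x j • i (dualToH i (e j))

/-- `w_n^⊥ = w - w_n`, where `w_n = ∑ j < n, (δ e_j)(w) • e_j`; for `e_j ∈ W*` the Wiener integral
`(δ e_j)(w)` is the value `e_j w`. -/
noncomputable def perp {H W : Type*} [NormedAddCommGroup H] [InnerProductSpace ℝ H]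
    [CompleteSpace H] [AddCommGroup W] [Module ℝ W] [TopologicalSpace W]
    (i : H →L[ℝ] W) (e : ℕ → StrongDual ℝ W) (n : ℕ) (w : W) : W :=
  w - spanPoint i e n (fun j => e j w)

/-- `C`-convexity: for every complete orthonormal basis of `H` contained in `W*` and every `n` (not
larger than the dimension of `H`), for almost all `w_n^⊥`, the section
`x ↦ F (w_n^⊥ + ∑ j < n, x j • e_j)` on `span {e_0, …, e_{n-1}} ≃ ℝⁿ` is equal, almost everywhere
with respect to Lebesgue measure (which has the same null sets as the law of `w_n`), to a convex
function. -/
def IsCConvex {H W : Type*} [NormedAddCommGroup H] [InnerProductSpace ℝ H]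
    [CompleteSpace H] [AddCommGroup W] [Module ℝ W] [TopologicalSpace W] [MeasurableSpace W]
    (i : H →L[ℝ] W) (μ : Measure W) (F : W → EReal) : Prop :=
  ∀ (N : ℕ∞) (e : ℕ → StrongDual ℝ W), IsBasisInDual i N e →
    ∀ n : ℕ, (n : ℕ∞) ≤ N → ∀ᵐ w ∂μ,
      ∃ g : (Fin n → ℝ) → EReal, IsConvexFun g ∧
        ∀ᵐ x : Fin n → ℝ, F (perp i e n w + spanPoint i e n x) = g x

end WienerConvexity

/-! The measure factors: if `(w, x)` has law `μ` times the standard Gaussian on ℝⁿ, then `w_n^⊥ + x`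
has law `μ` (`measurePreserving_replaceCoords`). By Fubini, statements about `μ`-almost every point
become statements about Lebesgue-almost every point of almost every section.

From H to C: Fubini turns H-convexity along `span {e_j}` into convexity of almost every section at
almost all pairs of points, for rational weights (`AEConvex`). In ℝⁿ such a function agrees a.e.
with its essential lower semicontinuous envelope, which is convex at every point. Convexity of the
envelope is an approximation argument (`essLower_combination_le`); the agreement uses Lebesgue
density points (`le_essLower_of_tendsto`).

From C to H: a unit vector coming from `W*` starts some admissible basis, so the case n = 1 gives
the inequality in all directions from `W*`. These are dense in `H`, and the limit rests on
continuity in measure of translations by `H` (`tendsto_measure_shift`). Both this and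
quasi-invariance follow from `measure_shift_le`, where an elementary inequality between Gaussian
densities takes the place of the Cameron–Martin formula. -/

namespace WienerConvexity

open Filter Metric Set Module InnerProductSpace
open scoped Topology ENNReal NNReal RealInnerProductSpace

/-! ### Convex combinations in the extended reals. -/

section ExtendedReal

theorem combination_le_coe {α : ℝ} (hα : α ∈ Icc (0 : ℝ) 1) {a b : EReal} {A B : ℝ}
    (ha : a ≤ A) (hb : b ≤ B) :
    (α : EReal) * a + ((1 - α : ℝ) : EReal) * b ≤ ((α * A + (1 - α) * B : ℝ) : EReal) := by
  have h0 : (0 : EReal) ≤ (α : EReal) := EReal.coe_nonneg.2 hα.1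
  have h1 : (0 : EReal) ≤ ((1 - α : ℝ) : EReal) := EReal.coe_nonneg.2 (by linarith [hα.2])
  rw [EReal.coe_add, EReal.coe_mul, EReal.coe_mul]
  exact add_le_add (mul_le_mul_of_nonneg_left ha h0) (mul_le_mul_of_nonneg_left hb h1)

/-- With both weights positive and neither value `⊥`, an infinite value makes the right side `⊤`;
otherwise rational upper bounds approximate it. At weights 0 and 1 this fails, since 0 * ∞ = 0, so
these are treated separately throughout. -/
theorem le_combination {α : ℝ} (hα : α ∈ Ioo (0 : ℝ) 1) {a b c : EReal}
    (ha : a ≠ ⊥) (hb : b ≠ ⊥)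
    (h : ∀ A B : ℚ, a < ((A : ℝ) : EReal) → b < ((B : ℝ) : EReal) →
      c ≤ ((α * A + (1 - α) * B : ℝ) : EReal)) :
    c ≤ (α : EReal) * a + ((1 - α : ℝ) : EReal) * b := by
  have hα' : 0 < 1 - α := by linarith [hα.2]
  have hmem : α ∈ Icc (0 : ℝ) 1 := Ioo_subset_Icc_self hα
  induction a with
  | bot => exact absurd rfl ha
  | top =>
    rw [EReal.coe_mul_top_of_pos hα.1, EReal.top_add_of_ne_bot]
    · exact le_top
    · rw [EReal.mul_ne_bot]
      exact ⟨Or.inl (EReal.coe_ne_bot _), Or.inr hb, Or.inl (EReal.coe_ne_top _),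
        Or.inl (EReal.coe_nonneg.2 hα'.le)⟩
  | coe a =>
    induction b with
    | bot => exact absurd rfl hb
    | top =>
      rw [EReal.coe_mul_top_of_pos hα', ← EReal.coe_mul, EReal.coe_add_top]
      exact le_top
    | coe b =>
      rw [← EReal.coe_mul, ← EReal.coe_mul, ← EReal.coe_add]
      refine le_of_forall_gt_imp_ge_of_dense fun d hd => ?_
      induction d with
      | bot => simp at hd
      | top => exact le_top
      | coe d =>
        rw [EReal.coe_lt_coe_iff] at hd
        set ε := d - (α * a + (1 - α) * b) with hε
        have hε0 : 0 < ε := by linarith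
        obtain ⟨A, hA1, hA2⟩ := exists_rat_btwn (show a < a + ε by linarith)
        obtain ⟨B, hB1, hB2⟩ := exists_rat_btwn (show b < b + ε by linarith)
        refine (h A B (EReal.coe_lt_coe_iff.2 hA1) (EReal.coe_lt_coe_iff.2 hB1)).trans ?_
        rw [EReal.coe_le_coe_iff]
        have e1 := mul_le_mul_of_nonneg_left hA2.le hα.1.le
        have e2 := mul_le_mul_of_nonneg_left hB2.le hα'.le
        nlinarith

theorem self_le_combination {α : ℝ} (hα : α ∈ Icc (0 : ℝ) 1) (a : EReal) :
    a ≤ (α : EReal) * a + ((1 - α : ℝ) : EReal) * a := by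
  rw [← EReal.right_distrib_of_nonneg (EReal.coe_nonneg.2 hα.1)
    (EReal.coe_nonneg.2 (by linarith [hα.2])), ← EReal.coe_add]
  simp

theorem combination_zero_one_le {α : ℝ} (hα : α = 0 ∨ α = 1) {E : Type*} [AddCommGroup E]
    [Module ℝ E] (F : E → EReal) (x y : E) :
    F (α • x + (1 - α) • y) ≤ (α : EReal) * F x + ((1 - α : ℝ) : EReal) * F y := by
  rcases hα with rfl | rfl <;> simp

end ExtendedReal

/-! ### Almost everywhere convex functions in finite dimension. -/

section FiniteDimensional

variable {E : Type*} [NormedAddCommGroup E] [MeasurableSpace E] {μ : Measure E}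

/-- The essential lower semicontinuous envelope of `f`. -/
noncomputable def essLower (μ : Measure E) (f : E → EReal) (x : E) : EReal :=
  sSup {c : EReal | ∃ r > 0, ∀ᵐ y ∂μ, y ∈ ball x r → c ≤ f y}

theorem exists_ball_of_lt_essLower {f : E → EReal} {x : E} {c : EReal}
    (h : c < essLower μ f x) : ∃ r > 0, ∀ᵐ y ∂μ, y ∈ ball x r → c ≤ f y := by
  obtain ⟨d, ⟨r, hr, hd⟩, hcd⟩ := lt_sSup_iff.1 h
  exact ⟨r, hr, hd.mono fun y hy hyr => hcd.le.trans (hy hyr)⟩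

theorem frequently_lt_of_essLower_lt {f : E → EReal} {x : E} {c : EReal}
    (h : essLower μ f x < c) {r : ℝ} (hr : 0 < r) : ∃ᵐ y ∂μ, y ∈ ball x r ∧ f y < c := by
  intro hn
  refine absurd (le_sSup (show c ∈ {c : EReal | ∃ r > 0, ∀ᵐ y ∂μ, y ∈ ball x r → c ≤ f y} from
    ⟨r, hr, hn.mono fun y hy hyr => ?_⟩)) (not_le.2 h)
  by_contra hc
  exact hy ⟨hyr, not_le.1 hc⟩

variable [NormedSpace ℝ E] [FiniteDimensional ℝ E]

theorem essLower_le_ae (f : E → EReal) : ∀ᵐ x ∂μ, essLower μ f x ≤ f x := by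
  have key : ∀ᵐ x ∂μ, ∀ U ∈ TopologicalSpace.countableBasis E, ∀ c : ℚ,
      (∀ᵐ y ∂μ, y ∈ U → ((c : ℝ) : EReal) ≤ f y) → x ∈ U → ((c : ℝ) : EReal) ≤ f x := by
    rw [ae_ball_iff (TopologicalSpace.countable_countableBasis E)]
    intro U _
    rw [ae_all_iff]
    intro c
    by_cases h : ∀ᵐ y ∂μ, y ∈ U → ((c : ℝ) : EReal) ≤ f y
    · exact h.mono fun x hx _ => hx
    · exact Eventually.of_forall fun x h' => absurd h' h
  filter_upwards [key] with x hx
  by_contra hlt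
  obtain ⟨c, hc1, hc2⟩ := EReal.lt_iff_exists_rat_btwn.1 (not_le.1 hlt)
  obtain ⟨r, hr, hr'⟩ := exists_ball_of_lt_essLower hc2
  obtain ⟨U, hU, hxU, hUr⟩ := (TopologicalSpace.isBasis_countableBasis E).exists_subset_of_mem_open
    (mem_ball_self hr) isOpen_ball
  exact absurd (hx U hU c (hr'.mono fun y hy hyU => hy (hUr hyU)) hxU) (not_le.2 hc1)

variable [BorelSpace E] [μ.IsAddHaarMeasure]

theorem quasiMeasurePreserving_add_smul (a : E) {s : ℝ} (hs : s ≠ 0) :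
    Measure.QuasiMeasurePreserving (fun v : E => a + s • v) μ μ :=
  (measurePreserving_add_left μ a).quasiMeasurePreserving.comp
    (Measure.quasiMeasurePreserving_smul μ hs)

/-- Almost everywhere convexity, for rational convex combinations. -/
def AEConvex (μ : Measure E) (f : E → EReal) : Prop :=
  ∀ q : ℚ, 0 < q → q < 1 → ∀ᵐ x ∂μ, ∀ᵐ y ∂μ,
    f ((q : ℝ) • x + (1 - (q : ℝ)) • y)
      ≤ ((q : ℝ) : EReal) * f x + ((1 - (q : ℝ) : ℝ) : EReal) * f y

/-- Near `x` and `y` there are positive-measure sets of points where `f` is below `A` and `B`.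
Combining typical such points gives values of `f` near the combination, which an essential lower
bound there cannot exceed. -/
theorem essLower_combination_le {f : E → EReal} (hf : AEConvex μ f) {x y : E} {A B α : ℝ}
    (hx : essLower μ f x < A) (hy : essLower μ f y < B) (hα : α ∈ Ioo (0 : ℝ) 1) :
    essLower μ f (α • x + (1 - α) • y) ≤ ((α * A + (1 - α) * B : ℝ) : EReal) := by
  by_contra hlt
  obtain ⟨c, hc1, hc2⟩ := EReal.lt_iff_exists_real_btwn.1 (not_le.1 hlt)
  rw [EReal.coe_lt_coe_iff] at hc1
  obtain ⟨r, hr, hr'⟩ := exists_ball_of_lt_essLower hc2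
  -- Almost everywhere convexity is only available for rational weights; all conditions on the
  -- weight are open, so `α` can be perturbed to a rational `q`.
  obtain ⟨q, ⟨⟨hq0, hq1⟩, hqz⟩, hqc⟩ : ∃ q : ℚ, ((q : ℝ) ∈ Ioo (0 : ℝ) 1 ∧
      (q : ℝ) • x + (1 - (q : ℝ)) • y ∈ ball (α • x + (1 - α) • y) (r / 2)) ∧
      (q : ℝ) * A + (1 - (q : ℝ)) * B < c := by
    have h1 : ∀ᶠ t : ℝ in 𝓝 α, t ∈ Ioo (0 : ℝ) 1 := isOpen_Ioo.mem_nhds hα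
    have h2 : ∀ᶠ t : ℝ in 𝓝 α, t • x + (1 - t) • y ∈ ball (α • x + (1 - α) • y) (r / 2) :=
      (by fun_prop : Continuous fun t : ℝ => t • x + (1 - t) • y).continuousAt.eventually
        (ball_mem_nhds _ (by positivity))
    have h3 : ∀ᶠ t : ℝ in 𝓝 α, t * A + (1 - t) * B < c :=
      (by fun_prop : Continuous fun t : ℝ => t * A + (1 - t) * B).continuousAt.eventually
        (gt_mem_nhds hc1)
    obtain ⟨U, hU, hUo, hαU⟩ := _root_.eventually_nhds_iff.1 ((h1.and h2).and h3)
    obtain ⟨q, hq⟩ := Rat.denseRange_cast (𝕜 := ℝ) |>.exists_mem_open hUo ⟨α, hαU⟩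
    exact ⟨q, hU _ hq⟩
  obtain ⟨u, ⟨hu1, hu2⟩, hu⟩ := ((frequently_lt_of_essLower_lt hx (half_pos hr)).and_eventually
    (hf q (by exact_mod_cast hq0) (by exact_mod_cast hq1))).exists
  have hne : (1 - (q : ℝ)) ≠ 0 := by linarith
  obtain ⟨v, ⟨hv1, hv2⟩, hv3, hv4⟩ :=
    ((frequently_lt_of_essLower_lt hy (half_pos hr)).and_eventually
    (hu.and ((quasiMeasurePreserving_add_smul ((q : ℝ) • u) hne).ae hr'))).exists
  have hball : (q : ℝ) • u + (1 - (q : ℝ)) • v ∈ ball (α • x + (1 - α) • y) r := by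
    have : dist ((q : ℝ) • u + (1 - (q : ℝ)) • v) ((q : ℝ) • x + (1 - (q : ℝ)) • y) < r / 2 := by
      rw [mem_ball, dist_eq_norm] at hu1 hv1
      rw [dist_eq_norm, show (q : ℝ) • u + (1 - (q : ℝ)) • v - ((q : ℝ) • x + (1 - (q : ℝ)) • y)
        = (q : ℝ) • (u - x) + (1 - (q : ℝ)) • (v - y) by module]
      refine (norm_add_le _ _).trans_lt ?_
      rw [norm_smul, norm_smul, Real.norm_of_nonneg hq0.le, Real.norm_of_nonneg (by linarith)]
      nlinarith
    rw [mem_ball] at hqz ⊢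
    linarith [dist_triangle ((q : ℝ) • u + (1 - (q : ℝ)) • v)
      ((q : ℝ) • x + (1 - (q : ℝ)) • y) (α • x + (1 - α) • y)]
  have := (hv4 hball).trans (hv3.trans (combination_le_coe ⟨hq0.le, hq1.le⟩ hu2.le hv2.le))
  rw [EReal.coe_le_coe_iff] at this
  linarith

/-- If the envelope at `x` were below `c' < c`, the set where `f < c'` could be contracted towards
points near `x`. Convexity keeps `f ≤ c'` on the images, so `{f < c}` fills a fixed fraction of
arbitrarily small balls about `x`, against density 1. -/
theorem le_essLower_of_tendsto {f : E → EReal} (hf : AEConvex μ f) (hfm : Measurable f)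
    {c : EReal} {x : E}
    (hx : Tendsto (fun r => μ ({y | c ≤ f y} ∩ closedBall x r) / μ (closedBall x r))
      (𝓝[>] 0) (𝓝 1)) : c ≤ essLower μ f x := by
  by_contra hlt
  obtain ⟨c', hc1, hc2⟩ := EReal.lt_iff_exists_real_btwn.1 (not_le.1 hlt)
  set S : Set E := {y | c ≤ f y} with hS
  have hSm : MeasurableSet S := measurableSet_le measurable_const hfm
  set A : Set E := {y | y ∈ ball x 1 ∧ f y < c'} with hA
  have hA0 : μ A ≠ 0 := frequently_ae_iff.1 (frequently_lt_of_essLower_lt hc1 one_pos)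
  set M := μ (closedBall (0 : E) 2) with hM
  have hMtop : M ≠ ∞ := measure_closedBall_lt_top.ne
  have hM0 : M ≠ 0 := (measure_closedBall_pos μ _ two_pos).ne'
  have hbound : ∀ k : ℕ, μ (S ∩ closedBall x (1 / ((k : ℝ) + 2) * 2)) /
      μ (closedBall x (1 / ((k : ℝ) + 2) * 2)) ≤ (M - μ A) / M := by
    intro k
    -- The contraction ratio; the 2 keeps `t < 1`, hence `q = 1 - t > 0`, also for `k = 0`.
    set t : ℝ := 1 / ((k : ℝ) + 2) with ht
    have ht0 : 0 < t := by positivity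
    have ht1 : t < 1 := by rw [ht, div_lt_one (by positivity)]; linarith [k.cast_nonneg (α := ℝ)]
    set q : ℚ := 1 - 1 / ((k : ℚ) + 2) with hq
    have hqt : (q : ℝ) = 1 - t := by rw [hq, ht]; push_cast; ring
    have hq0 : 0 < q := by
      have : (0 : ℝ) < q := by rw [hqt]; linarith
      exact_mod_cast this
    have hq1 : q < 1 := by
      have : (q : ℝ) < 1 := by rw [hqt]; linarith
      exact_mod_cast this
    obtain ⟨u, ⟨hu1, hu2⟩, hu⟩ := ((frequently_lt_of_essLower_lt hc1 ht0).and_eventually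
      (hf q hq0 hq1)).exists
    set G : Set E := {v | f ((q : ℝ) • u + (1 - (q : ℝ)) • v)
      ≤ ((q : ℝ) : EReal) * f u + ((1 - (q : ℝ) : ℝ) : EReal) * f v} with hG
    have hAG : μ (A ∩ G) = μ A := measure_inter_conull (mem_ae_iff.1 hu)
    -- With `u` within `t` of `x` and `v` within 1, the image is within `(1 - t) * t + t ≤ 2 * t` of
    -- `x`; hence the radius.
    have hsub : AffineMap.homothety u t '' (A ∩ G) ⊆ closedBall x (t * 2) \ S := by
      rintro _ ⟨v, ⟨⟨hv1, hv2⟩, hv3⟩, rfl⟩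
      have hform : AffineMap.homothety u t v = (q : ℝ) • u + (1 - (q : ℝ)) • v := by
        rw [hqt, AffineMap.homothety_apply]
        simp only [vsub_eq_sub, vadd_eq_add]
        module
      refine ⟨?_, fun hvS => ?_⟩
      · rw [hform, hqt, mem_closedBall, dist_eq_norm,
          show (1 - t) • u + (1 - (1 - t)) • v - x = (1 - t) • (u - x) + t • (v - x) by module]
        rw [mem_ball, dist_eq_norm] at hu1 hv1
        refine (norm_add_le _ _).trans ?_
        rw [norm_smul, norm_smul, Real.norm_of_nonneg ht0.le, Real.norm_of_nonneg (by linarith)]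
        nlinarith [norm_nonneg (u - x)]
      · rw [hform] at hvS
        have h1 : c ≤ _ := le_trans hvS (hv3.trans (combination_le_coe
          ⟨by exact_mod_cast hq0.le, by exact_mod_cast hq1.le⟩ hu2.le hv2.le))
        rw [show (q : ℝ) * c' + (1 - (q : ℝ)) * c' = c' by ring] at h1
        exact absurd hc2 (not_lt.2 h1)
    have hcb : μ (closedBall x (t * 2)) = ENNReal.ofReal (t ^ finrank ℝ E) * M :=
      Measure.addHaar_closedBall_mul_of_pos μ x ht0 2
    have hle := measure_mono (μ := μ) hsub
    rw [Measure.addHaar_image_homothety, hAG, abs_of_pos (by positivity)] at hle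
    have hadd := measure_inter_add_sdiff (μ := μ) (closedBall x (t * 2)) hSm
    set p := ENNReal.ofReal (t ^ finrank ℝ E) with hp
    have hp0 : p ≠ 0 := by rw [hp, Ne, ENNReal.ofReal_eq_zero, not_le]; positivity
    have hptop : p ≠ ∞ := ENNReal.ofReal_ne_top
    have h2 : μ (S ∩ closedBall x (t * 2)) ≤ p * (M - μ A) := by
      rw [ENNReal.mul_sub (fun _ _ => hptop), ← hcb, ← hadd, inter_comm]
      refine le_trans ?_ (tsub_le_tsub_left hle _)
      rw [ENNReal.add_sub_cancel_right]
      exact ((measure_mono sdiff_subset).trans_lt measure_closedBall_lt_top).ne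
    rw [hcb]
    calc μ (S ∩ closedBall x (t * 2)) / (p * M) ≤ p * (M - μ A) / (p * M) := by gcongr
      _ = (M - μ A) / M := ENNReal.mul_div_mul_left _ _ hp0 hptop
  have hlim : Tendsto (fun k : ℕ => 1 / ((k : ℝ) + 2) * 2) atTop (𝓝[>] 0) := by
    refine tendsto_nhdsWithin_iff.2 ⟨?_, Eventually.of_forall fun k => by
      simp only [mem_Ioi]; positivity⟩
    have h := (tendsto_one_div_add_atTop_nhds_zero_nat (𝕜 := ℝ)).comp (tendsto_add_atTop_nat 1)
    have h' := h.mul_const 2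
    rw [zero_mul] at h'
    refine h'.congr fun k => ?_
    simp only [Function.comp_apply]
    push_cast
    ring
  have h1 : (1 : ℝ≥0∞) ≤ (M - μ A) / M := le_of_tendsto' (hx.comp hlim) hbound
  have h2 : (M - μ A) / M < 1 := by
    rw [ENNReal.div_lt_iff (Or.inl hM0) (Or.inl hMtop), one_mul]
    exact ENNReal.sub_lt_self hMtop hM0 hA0
  exact absurd h1 (not_le.2 h2)

theorem essLower_ae_eq {f : E → EReal} (hf : AEConvex μ f) (hfm : Measurable f) :
    f =ᵐ[μ] essLower μ f := by
  have key : ∀ᵐ x ∂μ, ∀ c : ℚ, ((c : ℝ) : EReal) ≤ f x → ((c : ℝ) : EReal) ≤ essLower μ f x := by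
    rw [ae_all_iff]
    intro c
    have h := Besicovitch.ae_tendsto_measure_inter_div μ {y | ((c : ℝ) : EReal) ≤ f y}
    rw [ae_restrict_iff' (measurableSet_le measurable_const hfm)] at h
    exact h.mono fun x hx hxc => le_essLower_of_tendsto hf hfm (hx hxc)
  filter_upwards [key, essLower_le_ae (μ := μ) f] with x hx hx'
  refine le_antisymm ?_ hx'
  by_contra hlt
  obtain ⟨c, hc1, hc2⟩ := EReal.lt_iff_exists_rat_btwn.1 (not_le.1 hlt)
  exact absurd (hx c hc2.le) (not_le.2 hc1)

theorem essLower_ne_bot {f : E → EReal} (hf : AEConvex μ f) (hfm : Measurable f)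
    (hbot : ∀ᵐ x ∂μ, f x ≠ ⊥) (x : E) : essLower μ f x ≠ ⊥ := by
  intro hx
  have hae := essLower_ae_eq hf hfm
  have hhalf : (1 / 2 : ℝ) ∈ Ioo (0 : ℝ) 1 := by constructor <;> norm_num
  obtain ⟨y, ⟨⟨-, hy0⟩, hy⟩, hy'⟩ := ((frequently_lt_of_essLower_lt
    (show essLower μ f x < ((0 : ℝ) : EReal) by rw [hx]; exact EReal.bot_lt_coe 0)
    one_pos).and_eventually hae).and_eventually
    ((quasiMeasurePreserving_add_smul ((1 / 2 : ℝ) • x)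
      (show (1 - 1 / 2 : ℝ) ≠ 0 by norm_num)).ae (hae.and hbot)) |>.exists
  apply hy'.2
  rw [hy'.1]
  rw [hy] at hy0
  refine (EReal.eq_bot_iff_forall_lt _).2 fun c => ?_
  -- The midpoint bound is then `c - 1 < c` for every real `c`: a value `⊥` at `x` would force `⊥`
  -- at typical midpoints.
  refine (essLower_combination_le hf (A := 2 * c - 2) (B := 0) ?_ hy0 hhalf).trans_lt ?_
  · rw [hx]; exact EReal.bot_lt_coe _
  · rw [EReal.coe_lt_coe_iff]; linarith

theorem AEConvex.exists_isConvexFun {f : E → EReal} (hf : AEConvex μ f) (hfm : Measurable f)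
    (hbot : ∀ᵐ x ∂μ, f x ≠ ⊥) : ∃ g : E → EReal, IsConvexFun g ∧ f =ᵐ[μ] g := by
  refine ⟨essLower μ f, ⟨essLower_ne_bot hf hfm hbot, fun x y α hα => ?_⟩, essLower_ae_eq hf hfm⟩
  by_cases h : α = 0 ∨ α = 1
  · exact combination_zero_one_le h _ x y
  rw [not_or] at h
  have hα' : α ∈ Ioo (0 : ℝ) 1 := ⟨lt_of_le_of_ne hα.1 (Ne.symm h.1), lt_of_le_of_ne hα.2 h.2⟩
  exact le_combination hα' (essLower_ne_bot hf hfm hbot x) (essLower_ne_bot hf hfm hbot y)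
    fun A B hA hB => essLower_combination_le hf hA hB hα'

end FiniteDimensional

/-! ### Density of the image of `W*` in `H`. -/

section DualEmbedding

variable {H W : Type*} [NormedAddCommGroup H] [InnerProductSpace ℝ H]
  [CompleteSpace H] [AddCommGroup W] [Module ℝ W] [TopologicalSpace W] (i : H →L[ℝ] W)

theorem inner_dualToH (φ : StrongDual ℝ W) (h : H) : ⟪dualToH i φ, h⟫ = φ (i h) := by
  simp [dualToH]

/-- `dualToH` as a linear map. -/
noncomputable def dualToHₗ : StrongDual ℝ W →ₗ[ℝ] H where
  toFun := dualToH i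
  map_add' φ ψ := ext_inner_right ℝ fun h => by simp [inner_dualToH, inner_add_left]
  map_smul' c φ := ext_inner_right ℝ fun h => by simp [inner_dualToH, inner_smul_left]

@[simp]
theorem dualToHₗ_apply (φ : StrongDual ℝ W) : dualToHₗ i φ = dualToH i φ := rfl

theorem denseRange_dualToH [IsTopologicalAddGroup W] [ContinuousSMul ℝ W]
    [LocallyConvexSpace ℝ W] [T2Space W]
    (hi : Function.Injective i) : DenseRange (dualToH i) := by
  have h : (LinearMap.range (dualToHₗ i)).topologicalClosure = ⊤ := by
    rw [Submodule.topologicalClosure_eq_top_iff, Submodule.eq_bot_iff]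
    intro h hh
    by_contra hne
    have hne' : i h ≠ 0 := fun h0 => hne (hi (by rw [h0, map_zero]))
    obtain ⟨φ, hφ⟩ := geometric_hahn_banach_point_point hne'
    have := (Submodule.mem_orthogonal _ _).1 hh (dualToHₗ i φ) (LinearMap.mem_range_self _ _)
    rw [dualToHₗ_apply, inner_dualToH] at this
    simp [this] at hφ
  have h' := Submodule.dense_iff_topologicalClosure_eq_top.2 h
  rwa [LinearMap.coe_range] at h'

end DualEmbedding

/-! ### Measures are determined by their one-dimensional laws. -/

section Uniqueness

theorem measure_ext_of_map_linear {V D : Type*} [AddCommGroup V] [Module ℝ V] [UniformSpace V]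
    [(uniformity V).IsCountablyGenerated] [CompleteSpace V] [SecondCountableTopology V]
    [MeasurableSpace V] [BorelSpace V] [AddCommGroup D] [Module ℝ D] (L : V →ₗ[ℝ] D →ₗ[ℝ] ℝ)
    (hL : ∀ d, Continuous fun v => L v d) (hL0 : ∀ v ≠ 0, L v ≠ 0) {P P' : Measure V}
    [IsFiniteMeasure P] [IsFiniteMeasure P']
    (h : ∀ d, P.map (fun v => L v d) = P'.map (fun v => L v d)) : P = P' := by
  let := UniformSpace.pseudoMetricSpace V
  -- The discrete topology reduces joint continuity of the pairing to continuity in `v`.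
  let : TopologicalSpace D := ⊥
  have : DiscreteTopology D := ⟨rfl⟩
  have hLc : Continuous fun p : V × D => L p.1 p.2 := continuous_prod_of_discrete_right.2 hL
  refine ext_of_integral_char_eq Real.continuous_probChar
    Real.probChar_ne_one hL0 hLc fun d => ?_
  simp only [BoundedContinuousFunction.char_apply]
  have key : ∀ Q : Measure V, ∫ v, (Real.probChar (L v d) : ℂ) ∂Q
      = ∫ x, (Real.probChar x : ℂ) ∂(Q.map fun v => L v d) := by
    intro Q
    rw [integral_map (hL d).aemeasurable]
    exact (continuous_subtype_val.comp
      Real.continuous_probChar).aestronglyMeasurable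
  rw [key, key, h]

end Uniqueness

/-! ### Standard Gaussian measure on ℝⁿ and independent sums. -/

section Gaussian

/-- The standard Gaussian measure on `ℝⁿ`. -/
noncomputable def stdGaussianPi (n : ℕ) : Measure (Fin n → ℝ) :=
  Measure.pi fun _ => gaussianReal 0 1

instance (n : ℕ) : IsProbabilityMeasure (stdGaussianPi n) := by
  unfold stdGaussianPi; infer_instance

theorem pi_absolutelyContinuous {a b : Measure ℝ} [SigmaFinite a] [SigmaFinite b] (hab : a ≪ b)
    (n : ℕ) : (Measure.pi fun _ : Fin n => a) ≪ Measure.pi fun _ : Fin n => b := by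
  induction n with
  | zero => rw [Measure.pi_of_empty, Measure.pi_of_empty]
  | succ n ih =>
    have ha := measurePreserving_piFinSuccAbove (fun _ : Fin (n + 1) => a) 0
    have hb := measurePreserving_piFinSuccAbove (fun _ : Fin (n + 1) => b) 0
    have ha' := (ha.symm _).map_eq
    have hb' := (hb.symm _).map_eq
    rw [← ha', ← hb']
    exact (hab.prod ih).map (MeasurableEquiv.measurable _)

theorem volume_absolutelyContinuous_stdGaussianPi (n : ℕ) :
    (volume : Measure (Fin n → ℝ)) ≪ stdGaussianPi n :=
  pi_absolutelyContinuous (gaussianReal_absolutelyContinuous' 0 one_ne_zero) n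

theorem stdGaussianPi_absolutelyContinuous_volume (n : ℕ) :
    stdGaussianPi n ≪ (volume : Measure (Fin n → ℝ)) :=
  pi_absolutelyContinuous (gaussianReal_absolutelyContinuous 0 one_ne_zero) n

theorem map_add_sum_prod_stdGaussianPi {Ω : Type*} [MeasurableSpace Ω] {μ : Measure Ω}
    [IsProbabilityMeasure μ] {X : Ω → ℝ} (hX : Measurable X) {v : ℝ≥0}
    (hlaw : μ.map X = gaussianReal 0 v) {n : ℕ} (c : Fin n → ℝ) :
    (μ.prod (stdGaussianPi n)).map (fun p => X p.1 + ∑ j, c j * p.2 j)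
      = gaussianReal 0 (v + ∑ j, ‖c j‖₊ ^ 2) := by
  have hm : Measurable fun p : Ω × (Fin n → ℝ) => X p.1 + ∑ j, c j * p.2 j := by fun_prop
  have := Measure.isProbabilityMeasure_map (μ := μ.prod (stdGaussianPi n)) hm.aemeasurable
  refine Measure.ext_of_charFun (funext fun t => ?_)
  rw [charFun_apply_real, integral_map hm.aemeasurable (by fun_prop)]
  have hsplit : ∀ p : Ω × (Fin n → ℝ),
      Complex.exp (t * ((X p.1 + ∑ j, c j * p.2 j : ℝ) : ℂ) * Complex.I)
        = Complex.exp (t * (X p.1 : ℂ) * Complex.I) *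
          ∏ j, Complex.exp (((t * c j : ℝ) : ℂ) * (p.2 j : ℂ) * Complex.I) := by
    intro p
    rw [← Complex.exp_sum, ← Complex.exp_add]
    congr 1
    push_cast
    rw [mul_add, add_mul, Finset.mul_sum, Finset.sum_mul]
    congr 1
    exact Finset.sum_congr rfl fun j _ => by ring
  simp_rw [hsplit]
  rw [integral_prod_mul (fun w => Complex.exp (t * (X w : ℂ) * Complex.I))
    (fun x : Fin n → ℝ => ∏ j, Complex.exp (((t * c j : ℝ) : ℂ) * (x j : ℂ) * Complex.I)),
    stdGaussianPi, integral_fintype_prod_eq_prod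
      (f := fun j (y : ℝ) => Complex.exp (((t * c j : ℝ) : ℂ) * (y : ℂ) * Complex.I))]
  simp_rw [← charFun_apply_real]
  have h1 : ∫ w, Complex.exp (t * (X w : ℂ) * Complex.I) ∂μ = charFun (gaussianReal 0 v) t := by
    rw [← hlaw, charFun_apply_real, integral_map hX.aemeasurable (by fun_prop)]
  rw [h1]
  simp_rw [charFun_gaussianReal]
  rw [← Complex.exp_sum, ← Complex.exp_add]
  congr 1
  push_cast
  simp only [mul_zero, zero_mul, zero_sub, Real.norm_eq_abs, Finset.sum_neg_distrib, one_mul]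
  rw [add_mul, add_div, Finset.sum_mul, Finset.sum_div, neg_add]
  congr 2
  refine Finset.sum_congr rfl fun j _ => ?_
  have : ((|c j| : ℝ) : ℂ) ^ 2 = (c j : ℂ) ^ 2 := by norm_cast; exact sq_abs _
  rw [this]
  ring

end Gaussian

/-! ### Factoring `μ` along finitely many coordinates. -/

section Decomposition

variable {H W : Type*} [NormedAddCommGroup H] [InnerProductSpace ℝ H]
  [CompleteSpace H] [AddCommGroup W] [Module ℝ W]

section Algebra

variable [TopologicalSpace W] (i : H →L[ℝ] W)

/-- The point `w_n^⊥ + x`, as a function of `w` and `x`. -/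
noncomputable def replaceCoords (e : ℕ → StrongDual ℝ W) (n : ℕ) (p : W × (Fin n → ℝ)) : W :=
  perp i e n p.1 + spanPoint i e n p.2

theorem spanPoint_add (e : ℕ → StrongDual ℝ W) (n : ℕ) (x y : Fin n → ℝ) :
    spanPoint i e n (x + y) = spanPoint i e n x + spanPoint i e n y := by
  simp [spanPoint, add_smul, Finset.sum_add_distrib]

theorem spanPoint_smul (e : ℕ → StrongDual ℝ W) (n : ℕ) (a : ℝ) (x : Fin n → ℝ) :
    spanPoint i e n (a • x) = a • spanPoint i e n x := by
  simp [spanPoint, Finset.smul_sum, smul_smul]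

theorem spanPoint_eq (e : ℕ → StrongDual ℝ W) (n : ℕ) (x : Fin n → ℝ) :
    spanPoint i e n x = i (∑ j : Fin n, x j • dualToH i (e j)) := by
  simp [spanPoint, map_sum]

theorem replaceCoords_add (e : ℕ → StrongDual ℝ W) (n : ℕ) (w : W) (x y : Fin n → ℝ) :
    replaceCoords i e n (w, x + y) = replaceCoords i e n (w, x) + spanPoint i e n y := by
  simp [replaceCoords, spanPoint_add, add_assoc]

theorem apply_replaceCoords [IsTopologicalAddGroup W] [ContinuousConstSMul ℝ W]
    (e : ℕ → StrongDual ℝ W) (n : ℕ) (φ : StrongDual ℝ W)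
    (p : W × (Fin n → ℝ)) :
    φ (replaceCoords i e n p)
      = (φ - ∑ j : Fin n, φ (i (dualToH i (e j))) • e j) p.1
        + ∑ j : Fin n, φ (i (dualToH i (e j))) * p.2 j := by
  simp [replaceCoords, perp, spanPoint, map_sum, mul_comm]

theorem norm_sq_dualToH_sub (e : ℕ → StrongDual ℝ W) (n : ℕ)
    (he : Orthonormal ℝ fun j : Fin n => dualToH i (e j)) (φ : StrongDual ℝ W) :
    ‖dualToH i (φ - ∑ j : Fin n, φ (i (dualToH i (e j))) • e j)‖₊ ^ 2
      + ∑ j : Fin n, ‖φ (i (dualToH i (e j)))‖₊ ^ 2 = ‖dualToH i φ‖₊ ^ 2 := by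
  have h1 : dualToH i (φ - ∑ j : Fin n, φ (i (dualToH i (e j))) • e j)
      = dualToH i φ - ∑ j : Fin n, φ (i (dualToH i (e j))) • dualToH i (e j) := by
    simp only [← dualToHₗ_apply, map_sub, map_sum, map_smul]
  rw [h1]
  rw [← NNReal.coe_inj]
  push_cast
  rw [@norm_sub_sq ℝ, inner_sum, ← real_inner_self_eq_norm_sq (∑ j, _), he.inner_sum]
  simp only [inner_smul_right, inner_dualToH, Real.norm_eq_abs, sq_abs, RCLike.re_to_real,
    conj_trivial]
  simp only [← sq]
  ring

end Algebra

variable [UniformSpace W] [IsUniformAddGroup W] [ContinuousSMul ℝ W] (i : H →L[ℝ] W)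

theorem continuous_replaceCoords (e : ℕ → StrongDual ℝ W) (n : ℕ) :
    Continuous (replaceCoords i e n) := by
  unfold replaceCoords perp spanPoint
  fun_prop

variable [LocallyConvexSpace ℝ W] [CompleteSpace W] [(uniformity W).IsCountablyGenerated]
  [T2Space W] [MeasurableSpace W] [BorelSpace W] [SecondCountableTopology W] {i} {μ : Measure W}

/-- Under the product law, each `φ` splits into independent Gaussians: the part of `φ` orthogonal to
the `e_j`, evaluated at `w`, and a combination of the `x_j`. Their variances add up to `|φ̃|²` by
Pythagoras, and one-dimensional laws determine the measure. -/
theorem measurePreserving_replaceCoords (hμ : IsAbstractWienerSpace i μ)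
    {e : ℕ → StrongDual ℝ W} {n : ℕ} (he : Orthonormal ℝ fun j : Fin n => dualToH i (e j)) :
    MeasurePreserving (replaceCoords i e n) (μ.prod (stdGaussianPi n)) μ := by
  have := hμ.isProbabilityMeasure
  have hm : Measurable (replaceCoords i e n) := (continuous_replaceCoords i e n).measurable
  refine ⟨hm, ?_⟩
  have := Measure.isProbabilityMeasure_map (μ := μ.prod (stdGaussianPi n)) hm.aemeasurable
  let L : W →ₗ[ℝ] StrongDual ℝ W →ₗ[ℝ] ℝ :=
    LinearMap.mk₂ ℝ (fun w φ => φ w) (fun _ _ _ => map_add _ _ _) (fun _ _ _ => map_smul _ _ _)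
      (fun _ _ _ => rfl) (fun _ _ _ => rfl)
  refine measure_ext_of_map_linear L (fun φ => φ.continuous) (fun w hw h0 => ?_) fun φ => ?_
  · obtain ⟨φ, hφ⟩ := geometric_hahn_banach_point_point hw
    have h1 : L w φ = 0 := by rw [h0]; rfl
    have h2 : φ w = 0 := h1
    simp [h2] at hφ
  · change Measure.map φ _ = Measure.map φ _
    rw [Measure.map_map φ.continuous.measurable hm, hμ.map_eq_gaussianReal φ,
      ← norm_sq_dualToH_sub i e n he φ, ← map_add_sum_prod_stdGaussianPi
        (φ - ∑ j : Fin n, φ (i (dualToH i (e j))) • e j).continuous.measurable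
        (hμ.map_eq_gaussianReal _)]
    congr 1
    exact funext fun p => apply_replaceCoords i e n φ p

theorem quasiMeasurePreserving_replaceCoords (hμ : IsAbstractWienerSpace i μ)
    {e : ℕ → StrongDual ℝ W} {n : ℕ} (he : Orthonormal ℝ fun j : Fin n => dualToH i (e j)) :
    Measure.QuasiMeasurePreserving (replaceCoords i e n)
      (μ.prod (volume : Measure (Fin n → ℝ))) μ := by
  have := hμ.isProbabilityMeasure
  have h := measurePreserving_replaceCoords hμ he
  exact h.quasiMeasurePreserving.mono_left
    (Measure.AbsolutelyContinuous.rfl.prod (volume_absolutelyContinuous_stdGaussianPi n))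

theorem ae_of_ae_replaceCoords (hμ : IsAbstractWienerSpace i μ)
    {e : ℕ → StrongDual ℝ W} {n : ℕ} (he : Orthonormal ℝ fun j : Fin n => dualToH i (e j))
    {p : W → Prop} (hp : MeasurableSet {w | p w})
    (h : ∀ᵐ w ∂μ, ∀ᵐ x : Fin n → ℝ, p (replaceCoords i e n (w, x))) : ∀ᵐ w ∂μ, p w := by
  have := hμ.isProbabilityMeasure
  have hP := measurePreserving_replaceCoords hμ he
  rw [← hP.map_eq, ae_map_iff hP.measurable.aemeasurable hp,
    Measure.ae_prod_iff_ae_ae (p := fun z => p (replaceCoords i e n z)) (hP.measurable hp)]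
  exact h.mono fun w hw => (stdGaussianPi_absolutelyContinuous_volume n).ae_le hw

end Decomposition

/-! ### Translation estimate for the one-dimensional Gaussian. -/

section GaussianShift

/-- The densities satisfy `p_t² = exp (t²) * p_{2t} * p_0`, so the arithmetic-geometric inequality
with free weight `l` bounds `p_t`. Small `l` makes the first term small, leaving a multiple of the
unshifted measure. -/
theorem gaussianReal_le_add_smul (t : ℝ) {l : ℝ} (hl : 0 < l) (S : Set ℝ) :
    gaussianReal t 1 S
      ≤ ENNReal.ofReal (l * Real.exp (t ^ 2)) + ENNReal.ofReal l⁻¹ * gaussianReal 0 1 S := by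
  have hpt : ∀ x, gaussianPDF t 1 x
      ≤ ENNReal.ofReal (l * Real.exp (t ^ 2)) * gaussianPDF (2 * t) 1 x
      + ENNReal.ofReal l⁻¹ * gaussianPDF 0 1 x := by
    intro x
    simp only [gaussianPDF]
    rw [← ENNReal.ofReal_mul (by positivity), ← ENNReal.ofReal_mul (by positivity),
      ← ENNReal.ofReal_add (mul_nonneg (by positivity) (gaussianPDFReal_nonneg _ _ _))
        (mul_nonneg (by positivity) (gaussianPDFReal_nonneg _ _ _))]
    refine ENNReal.ofReal_le_ofReal ?_
    have hsq : gaussianPDFReal t 1 x ^ 2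
        = (l * Real.exp (t ^ 2) * gaussianPDFReal (2 * t) 1 x) * (l⁻¹ * gaussianPDFReal 0 1 x) := by
      have hl' : l * l⁻¹ = 1 := mul_inv_cancel₀ hl.ne'
      simp only [gaussianPDFReal, NNReal.coe_one, mul_one]
      set k := (√(2 * Real.pi))⁻¹
      have h : Real.exp (-(x - t) ^ 2 / 2) ^ 2
          = Real.exp (t ^ 2) * Real.exp (-(x - 2 * t) ^ 2 / 2) * Real.exp (-(x - 0) ^ 2 / 2) := by
        rw [← Real.exp_nat_mul, ← Real.exp_add, ← Real.exp_add]
        congr 1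
        push_cast
        ring
      rw [mul_pow, h]
      linear_combination (-(k ^ 2 * (Real.exp (t ^ 2) * Real.exp (-(x - 2 * t) ^ 2 / 2) *
        Real.exp (-(x - 0) ^ 2 / 2)))) * hl'
    have h1 : 0 ≤ l * Real.exp (t ^ 2) * gaussianPDFReal (2 * t) 1 x :=
      mul_nonneg (by positivity) (gaussianPDFReal_nonneg _ _ _)
    have h2 : 0 ≤ l⁻¹ * gaussianPDFReal 0 1 x :=
      mul_nonneg (by positivity) (gaussianPDFReal_nonneg _ _ _)
    refine le_of_sq_le_sq ?_ (add_nonneg h1 h2)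
    rw [hsq]
    nlinarith
  have hm : ∀ s, Measurable (gaussianPDF s 1) := fun s => measurable_gaussianPDF s 1
  calc gaussianReal t 1 S = ∫⁻ x in S, gaussianPDF t 1 x := gaussianReal_apply t one_ne_zero S
    _ ≤ ∫⁻ x in S, (ENNReal.ofReal (l * Real.exp (t ^ 2)) * gaussianPDF (2 * t) 1 x
          + ENNReal.ofReal l⁻¹ * gaussianPDF 0 1 x) := lintegral_mono hpt
    _ = ENNReal.ofReal (l * Real.exp (t ^ 2)) * gaussianReal (2 * t) 1 S
          + ENNReal.ofReal l⁻¹ * gaussianReal 0 1 S := by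
      rw [lintegral_add_left ((hm _).const_mul _), lintegral_const_mul _ (hm _),
        lintegral_const_mul _ (hm _), gaussianReal_apply _ one_ne_zero,
        gaussianReal_apply _ one_ne_zero]
    _ ≤ _ := by
      gcongr
      exact (mul_le_mul_right prob_le_one _).trans_eq (mul_one _)

theorem stdGaussianPi_one_shift_le (t : ℝ) {l : ℝ} (hl : 0 < l) {S : Set (Fin 1 → ℝ)}
    (hS : MeasurableSet S) :
    stdGaussianPi 1 {x | x + (fun _ => t) ∈ S}
      ≤ ENNReal.ofReal (l * Real.exp (t ^ 2)) + ENNReal.ofReal l⁻¹ * stdGaussianPi 1 S := by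
  have h := (measurePreserving_funUnique (gaussianReal 0 1) (Fin 1)).symm
  have hpi : stdGaussianPi 1
      = (gaussianReal 0 1).map (MeasurableEquiv.funUnique (Fin 1) ℝ).symm := by
    rw [h.map_eq, stdGaussianPi]
    congr
  have hm : MeasurableSet {x : Fin 1 → ℝ | x + (fun _ => t) ∈ S} :=
    (show Measurable fun x : Fin 1 → ℝ => x + fun _ => t by fun_prop) hS
  rw [hpi, Measure.map_apply h.measurable hm, Measure.map_apply h.measurable hS]
  refine le_trans (le_of_eq ?_) (gaussianReal_le_add_smul t hl _)
  have h2 := gaussianReal_map_add_const (μ := 0) (v := 1) t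
  rw [zero_add] at h2
  rw [← h2, Measure.map_apply (measurable_add_const t) (h.measurable hS)]
  rfl

end GaussianShift

/-! ### Quasi-invariance and continuity of translations by `H`. -/

section WienerShift

variable {H W : Type*} [NormedAddCommGroup H] [InnerProductSpace ℝ H]
  [AddCommGroup W] [Module ℝ W] [UniformSpace W] [IsUniformAddGroup W]
  [MeasurableSpace W] [BorelSpace W] {i : H →L[ℝ] W} {μ : Measure W}

theorem tendsto_measure_shift_open [IsFiniteMeasure μ] {U : Set W} (hU : IsOpen U) {h : H}
    {hs : ℕ → H} (hh : Tendsto hs atTop (𝓝 h)) :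
    Tendsto (fun m => μ {w | w + i h ∈ U ∧ w + i (hs m) ∉ U}) atTop (𝓝 0) := by
  have hm : ∀ k : H, MeasurableSet {w : W | w + i k ∈ U} := fun k =>
    (show Measurable fun w : W => w + i k by fun_prop) hU.measurableSet
  rw [← measure_empty (μ := μ)]
  refine tendsto_measure_of_tendsto_indicator_of_isFiniteMeasure _ μ
    (fun m => (hm h).inter (hm (hs m)).compl) fun w => ?_
  by_cases hw : w + i h ∈ U
  · have : Tendsto (fun m => w + i (hs m)) atTop (𝓝 (w + i h)) :=
      tendsto_const_nhds.add ((i.continuous.tendsto h).comp hh)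
    filter_upwards [this.eventually (hU.mem_nhds hw)] with m hm
    exact ⟨fun hx => absurd hm hx.2, fun hx => absurd hx (notMem_empty w)⟩
  · simp [hw]

variable [CompleteSpace H] [ContinuousSMul ℝ W]
  [LocallyConvexSpace ℝ W] [CompleteSpace W] [(uniformity W).IsCountablyGenerated]
  [T2Space W] [SecondCountableTopology W]

/-- Along a unit vector from `W*` the translation moves only the coordinate `x` of the
factorization, so the one-dimensional bound integrates over `w`. -/
theorem measure_shift_smul_le (hμ : IsAbstractWienerSpace i μ) {e : StrongDual ℝ W}
    (he : ‖dualToH i e‖ = 1) (t : ℝ) {l : ℝ} (hl : 0 < l) {B : Set W} (hB : MeasurableSet B) :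
    μ {w | w + t • i (dualToH i e) ∈ B}
      ≤ ENNReal.ofReal (l * Real.exp (t ^ 2)) + ENNReal.ofReal l⁻¹ * μ B := by
  have := hμ.isProbabilityMeasure
  have horth : Orthonormal ℝ fun j : Fin 1 => dualToH i ((fun _ : ℕ => e) j) :=
    ⟨fun _ => he, fun a b hab => absurd (Subsingleton.elim a b) hab⟩
  have hP := measurePreserving_replaceCoords (e := fun _ => e) hμ horth
  set P := replaceCoords i (fun _ => e) 1 with hPdef
  have hm : MeasurableSet {w : W | w + t • i (dualToH i e) ∈ B} :=
    (show Measurable fun w : W => w + t • i (dualToH i e) by fun_prop) hB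
  have hPB := hP.measurable hB
  rw [← hP.measure_preimage hB.nullMeasurableSet,
    ← hP.measure_preimage hm.nullMeasurableSet, Measure.prod_apply hPB,
    Measure.prod_apply (hP.measurable hm)]
  calc ∫⁻ w, stdGaussianPi 1 (Prod.mk w ⁻¹' (P ⁻¹' {w | w + t • i (dualToH i e) ∈ B})) ∂μ
      ≤ ∫⁻ w, (ENNReal.ofReal (l * Real.exp (t ^ 2)) +
          ENNReal.ofReal l⁻¹ * stdGaussianPi 1 (Prod.mk w ⁻¹' (P ⁻¹' B))) ∂μ := by
        refine lintegral_mono fun w => ?_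
        refine le_trans (le_of_eq ?_) (stdGaussianPi_one_shift_le t hl (measurable_prodMk_left hPB))
        congr 1
        ext x
        simp [hPdef, replaceCoords_add, spanPoint]
    _ = _ := by
        rw [lintegral_add_left measurable_const, lintegral_const, measure_univ, mul_one,
          lintegral_const_mul _ (measurable_measure_prodMk_left hPB)]

theorem measure_shift_dualToH_le (hμ : IsAbstractWienerSpace i μ) (φ : StrongDual ℝ W)
    {l : ℝ} (hl : 0 < l) {B : Set W} (hB : MeasurableSet B) :
    μ {w | w + i (dualToH i φ) ∈ B}
      ≤ ENNReal.ofReal (l * Real.exp (‖dualToH i φ‖ ^ 2)) + ENNReal.ofReal l⁻¹ * μ B := by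
  have := hμ.isProbabilityMeasure
  by_cases h0 : dualToH i φ = 0
  · simp only [h0, map_zero, add_zero, norm_zero, ofPred_mem_eq]
    rcases le_total 1 l with h1 | h1
    · refine le_add_right (prob_le_one.trans ?_)
      simpa using h1
    · refine le_add_left ?_
      have : 1 ≤ ENNReal.ofReal l⁻¹ := by simpa using (one_le_inv₀ hl).2 h1
      exact le_mul_of_one_le_left' this
  · have hn : ‖dualToH i φ‖ ≠ 0 := norm_ne_zero_iff.2 h0
    have hsm : dualToH i (‖dualToH i φ‖⁻¹ • φ) = ‖dualToH i φ‖⁻¹ • dualToH i φ := by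
      simp only [← dualToHₗ_apply, map_smul]
    have he : ‖dualToH i (‖dualToH i φ‖⁻¹ • φ)‖ = 1 := by
      rw [hsm, norm_smul, norm_inv, norm_norm, inv_mul_cancel₀ hn]
    have := measure_shift_smul_le hμ he ‖dualToH i φ‖ hl hB
    rwa [hsm, map_smul, smul_smul, mul_inv_cancel₀ hn, one_smul] at this

/-- The constants depend on `h` only through its norm. For open sets the bound therefore passes to
limits of directions from `W*`; outer regularity then gives arbitrary sets. -/
theorem measure_shift_le (hμ : IsAbstractWienerSpace i μ) (h : H)
    {l : ℝ} (hl : 0 < l) (B : Set W) :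
    μ {w | w + i h ∈ B}
      ≤ ENNReal.ofReal (l * Real.exp (‖h‖ ^ 2)) + ENNReal.ofReal l⁻¹ * μ B := by
  have := hμ.isProbabilityMeasure
  have hopen : ∀ U, IsOpen U → μ {w | w + i h ∈ U}
      ≤ ENNReal.ofReal (l * Real.exp (‖h‖ ^ 2)) + ENNReal.ofReal l⁻¹ * μ U := by
    intro U hU
    obtain ⟨hs, hs1, hs2⟩ := mem_closure_iff_seq_limit.1 (denseRange_dualToH i hμ.injective h)
    choose φ hφ using hs1
    have hlim : Tendsto (fun m => μ {w | w + i h ∈ U ∧ w + i (hs m) ∉ U} +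
        (ENNReal.ofReal (l * Real.exp (‖hs m‖ ^ 2)) + ENNReal.ofReal l⁻¹ * μ U)) atTop
        (𝓝 (0 + (ENNReal.ofReal (l * Real.exp (‖h‖ ^ 2)) + ENNReal.ofReal l⁻¹ * μ U))) := by
      refine (tendsto_measure_shift_open hU hs2).add (Tendsto.add ?_ tendsto_const_nhds)
      have hc : Continuous fun k : H => ENNReal.ofReal (l * Real.exp (‖k‖ ^ 2)) :=
        ENNReal.continuous_ofReal.comp (by fun_prop)
      exact (hc.tendsto h).comp hs2
    rw [zero_add] at hlim
    refine ge_of_tendsto' hlim fun m => ?_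
    have h1 := measure_shift_dualToH_le hμ (φ m) hl hU.measurableSet
    rw [hφ] at h1
    refine le_trans (measure_mono fun w hw => ?_) ((measure_union_le _ _).trans
      (add_le_add_right h1 _))
    by_cases hw' : w + i (hs m) ∈ U
    · exact Or.inr hw'
    · exact Or.inl ⟨hw, hw'⟩
  have hlim : Tendsto (fun δ : ℝ≥0∞ => ENNReal.ofReal (l * Real.exp (‖h‖ ^ 2)) +
      ENNReal.ofReal l⁻¹ * (μ B + δ)) (𝓝[>] 0)
      (𝓝 (ENNReal.ofReal (l * Real.exp (‖h‖ ^ 2)) + ENNReal.ofReal l⁻¹ * (μ B + 0))) := by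
    refine (Tendsto.add tendsto_const_nhds (ENNReal.Tendsto.const_mul
      (tendsto_const_nhds.add tendsto_id) (Or.inr ENNReal.ofReal_ne_top))).mono_left
      nhdsWithin_le_nhds
  rw [add_zero] at hlim
  refine ge_of_tendsto hlim ?_
  filter_upwards [self_mem_nhdsWithin] with δ hδ
  obtain ⟨U, hBU, hUo, hU⟩ := B.exists_isOpen_lt_add (measure_ne_top μ B) (ne_of_gt hδ)
  exact (measure_mono (fun w hw => hBU hw : {w | w + i h ∈ B} ⊆ {w | w + i h ∈ U})).trans
    ((hopen U hUo).trans
    (add_le_add_right (mul_le_mul_right hU.le _) _))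

theorem exists_small_const (C : ℝ≥0∞) (hC : C ≠ ∞) {ε : ℝ≥0∞} (hε : ε ≠ 0) :
    ∃ l : ℝ, 0 < l ∧ ENNReal.ofReal l * C ≤ ε := by
  obtain ⟨n, hn, hn'⟩ := ENNReal.exists_nnreal_pos_mul_lt hC hε
  exact ⟨n, hn, by simpa using hn'.le⟩

theorem quasiMeasurePreserving_shift (hμ : IsAbstractWienerSpace i μ) (h : H) :
    Measure.QuasiMeasurePreserving (fun w => w + i h) μ μ := by
  have hm : Measurable fun w : W => w + i h := by fun_prop
  refine ⟨hm, Measure.AbsolutelyContinuous.mk fun B hB hB0 => ?_⟩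
  rw [Measure.map_apply hm hB]
  by_contra hne
  obtain ⟨l, hl, hl'⟩ := exists_small_const (ENNReal.ofReal (Real.exp (‖h‖ ^ 2)))
    ENNReal.ofReal_ne_top (ENNReal.half_pos hne).ne'
  have h1 := measure_shift_le hμ h hl B
  rw [hB0, mul_zero, add_zero, ENNReal.ofReal_mul hl.le] at h1
  have := hμ.isProbabilityMeasure
  exact absurd (h1.trans hl') (not_le.2 (ENNReal.half_lt_self hne (measure_ne_top _ _)))

theorem tendsto_measure_shift (hμ : IsAbstractWienerSpace i μ) {B : Set W} (hB : MeasurableSet B)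
    {h : H} {hs : ℕ → H} (hh : Tendsto hs atTop (𝓝 h)) :
    Tendsto (fun m => μ {w | w + i h ∈ B ∧ w + i (hs m) ∉ B}) atTop (𝓝 0) := by
  have := hμ.isProbabilityMeasure
  rw [ENNReal.tendsto_nhds_zero]
  intro ε hε
  have hε3 : ε / 3 ≠ 0 := (ENNReal.div_pos hε.ne' (by simp)).ne'
  set C := Real.exp (‖h‖ ^ 2) + 1 with hC
  obtain ⟨l, hl, hl'⟩ := exists_small_const (ENNReal.ofReal C) ENNReal.ofReal_ne_top hε3
  have hli : ENNReal.ofReal l⁻¹ ≠ 0 := by simpa using hl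
  obtain ⟨U, hBU, hUo, -, hU⟩ := hB.exists_isOpen_sdiff_lt (measure_ne_top μ B)
    (ε := ε / 3 / ENNReal.ofReal l⁻¹) (ENNReal.div_pos hε3 ENNReal.ofReal_ne_top).ne'
  have hC' : ∀ᶠ m in atTop, Real.exp (‖hs m‖ ^ 2) < C := by
    have hc : Continuous fun k : H => Real.exp (‖k‖ ^ 2) := by fun_prop
    exact ((hc.tendsto h).comp hh).eventually (gt_mem_nhds (by rw [hC]; linarith))
  filter_upwards [hC', ENNReal.tendsto_nhds_zero.1 (tendsto_measure_shift_open (μ := μ) (i := i)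
    hUo hh) (ε / 3) (pos_iff_ne_zero.2 hε3)] with m hm1 hm2
  -- The translation bound is uniform over the bounded norms `‖hs m‖`, so the error from replacing
  -- `B` by `U` is small for all these `m` at once.
  have h1 : μ {w | w + i (hs m) ∈ U \ B} ≤ ε / 3 + ε / 3 := by
    refine (measure_shift_le hμ (hs m) hl _).trans (add_le_add ?_ ?_)
    · rw [ENNReal.ofReal_mul hl.le]
      exact (mul_le_mul_right (ENNReal.ofReal_le_ofReal hm1.le) _).trans hl'
    · exact (mul_le_mul_right hU.le _).trans ENNReal.mul_div_le
  refine le_trans (measure_mono fun w hw => ?_) ((measure_union_le _ _).trans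
    ((add_le_add hm2 h1).trans_eq ?_))
  · by_cases hw' : w + i (hs m) ∈ U
    · exact Or.inr ⟨hw', hw.2⟩
    · exact Or.inl ⟨hBU hw.1, hw'⟩
  · rw [← add_assoc, ENNReal.add_thirds]

end WienerShift

/-! ### Completing a unit vector to a basis contained in `W*`. -/

section Basis

variable {H W : Type*} [NormedAddCommGroup H] [InnerProductSpace ℝ H]
  [CompleteSpace H] [AddCommGroup W] [Module ℝ W] [TopologicalSpace W] {i : H →L[ℝ] W}

theorem IsBasisInDual.orthonormal_fin {N : ℕ∞} {e : ℕ → StrongDual ℝ W}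
    (he : IsBasisInDual i N e) {n : ℕ} (hn : (n : ℕ∞) ≤ N) :
    Orthonormal ℝ fun j : Fin n => dualToH i (e j) :=
  he.1.comp (fun j : Fin n => ⟨j, (by exact_mod_cast j.2 : ((j : ℕ) : ℕ∞) < n).trans_le hn⟩)
    fun _ _ h => Fin.ext (congrArg Subtype.val h)

theorem exists_isBasisInDual [TopologicalSpace.SeparableSpace H]
    (hd : DenseRange (dualToH i)) {φ : StrongDual ℝ W}
    (hφ : ‖dualToH i φ‖ = 1) :
    ∃ (N : ℕ∞) (e : ℕ → StrongDual ℝ W), IsBasisInDual i N e ∧ e 0 = φ ∧ 1 ≤ N := by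
  have : SecondCountableTopology H := UniformSpace.secondCountable_of_separable H
  set R := LinearMap.range (dualToHₗ i) with hR
  have hRd : R.topologicalClosure = ⊤ := by
    refine Submodule.dense_iff_topologicalClosure_eq_top.1 ?_
    rw [hR, LinearMap.coe_range]
    exact hd
  -- Gram–Schmidt uses finite linear combinations, so starting from vectors in the image of `W*` it
  -- stays there.
  let d : ℕ → H := fun n => Nat.casesOn n (dualToH i φ) fun k =>
    (TopologicalSpace.denseSeq R k : H)
  have hdR : Submodule.span ℝ (range d) ≤ R := by
    rw [Submodule.span_le]
    rintro _ ⟨n, rfl⟩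
    cases n with
    | zero => exact LinearMap.mem_range_self (dualToHₗ i) φ
    | succ k => exact (TopologicalSpace.denseSeq R k).2
  have hspan : (Submodule.span ℝ (range d)).topologicalClosure = ⊤ := by
    rw [eq_top_iff, ← hRd]
    refine Submodule.topologicalClosure_minimal _ (fun x hx => ?_)
      (Submodule.isClosed_topologicalClosure _)
    have hx' := TopologicalSpace.denseRange_denseSeq R ⟨x, hx⟩
    have := image_closure_subset_closure_image (continuous_subtype_val (p := (· ∈ R)))
      (mem_image_of_mem _ hx')
    refine closure_mono ?_ this
    rintro _ ⟨_, ⟨k, rfl⟩, rfl⟩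
    exact Submodule.subset_span ⟨k + 1, rfl⟩
  set g := gramSchmidtNormed ℝ d with hg
  have hgspan : Submodule.span ℝ (range g) = Submodule.span ℝ (range d) := by
    rw [hg, span_gramSchmidtNormed_range, span_gramSchmidt]
  have hgR : ∀ n, ∃ ψ, dualToH i ψ = g n := fun n =>
    hdR (hgspan ▸ Submodule.subset_span (mem_range_self n))
  choose ψ hψ using hgR
  have hg0 : g 0 = dualToH i φ := by
    have h0 : gramSchmidt ℝ d 0 = dualToH i φ := gramSchmidt_bot ℝ d
    rw [hg, gramSchmidtNormed, h0, hφ]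
    simp
  -- Dependent vectors yield zeros; `Nat.nth` renumbers the nonzero ones, whose count is `N`.
  set p : ℕ → Prop := fun n => g n ≠ 0 with hp
  have hp0 : p 0 := by
    rw [hp]
    simp only [hg0]
    exact norm_ne_zero_iff.1 (by rw [hφ]; exact one_ne_zero)
  have hn0 : Nat.nth p 0 = 0 := Nat.nth_zero_of_zero hp0
  set e : ℕ → StrongDual ℝ W := fun j => if j = 0 then φ else ψ (Nat.nth p j) with he
  have heg : ∀ j, dualToH i (e j) = g (Nat.nth p j) := by
    intro j
    by_cases hj : j = 0
    · simp [he, hj, hn0, hg0]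
    · simp [he, hj, hψ]
  set N : ℕ∞ := (Set.ofPred p).encard with hN
  have hlt : ∀ j : ℕ, (j : ℕ∞) < N ↔ ∀ hf : (Set.ofPred p).Finite, j < hf.toFinset.card := by
    intro j
    constructor
    · intro h hf
      rw [hN, hf.encard_eq_coe_toFinset_card] at h
      exact_mod_cast h
    · intro h
      by_cases hf : (Set.ofPred p).Finite
      · rw [hN, hf.encard_eq_coe_toFinset_card]
        exact_mod_cast h hf
      · rw [hN, Set.Infinite.encard_eq hf]
        exact ENat.natCast_lt_top j
  refine ⟨N, e, ⟨?_, ?_⟩, by simp [he], ?_⟩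
  · have horth := gramSchmidtNormed_orthonormal' (𝕜 := ℝ) d
    let u : {j : ℕ // (j : ℕ∞) < N} → {n | gramSchmidtNormed ℝ d n ≠ 0} := fun j =>
      ⟨Nat.nth p j, Nat.nth_mem (p := p) j ((hlt j).1 j.2)⟩
    have hu : Function.Injective u := by
      intro a b hab
      have hab' : Nat.nth p a = Nat.nth p b := congrArg Subtype.val hab
      rcases lt_trichotomy (a : ℕ) b with h | h | h
      · exact absurd hab' (Nat.nth_lt_nth' h ((hlt b).1 b.2)).ne
      · exact Subtype.ext h
      · exact absurd hab' (Nat.nth_lt_nth' h ((hlt a).1 a.2)).ne'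
    have := horth.comp u hu
    refine Eq.subst (motive := fun v => Orthonormal ℝ v) (funext fun j => ?_) this
    exact (heg j).symm
  · rw [eq_top_iff, ← hspan, ← hgspan]
    refine Submodule.topologicalClosure_mono (Submodule.span_le.2 ?_)
    rintro _ ⟨n, rfl⟩
    by_cases hn : g n = 0
    · rw [hn]; exact Submodule.zero_mem _
    · obtain ⟨j, hj, hj'⟩ := Nat.exists_lt_card_nth_eq (p := p) hn
      refine Submodule.subset_span ⟨⟨j, (hlt j).2 hj⟩, ?_⟩
      change dualToH i (e j) = g n
      rw [heg, hj']
  · rw [Order.one_le_iff_pos, hN, Set.encard_pos]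
    exact ⟨0, hp0⟩

end Basis

/-! ### The two implications. -/

section Equivalence

variable {H W : Type*} [NormedAddCommGroup H] [InnerProductSpace ℝ H]
  [CompleteSpace H] [AddCommGroup W] [Module ℝ W]
  [UniformSpace W] [IsUniformAddGroup W] [ContinuousSMul ℝ W]
  [LocallyConvexSpace ℝ W] [CompleteSpace W] [(uniformity W).IsCountablyGenerated]
  [T2Space W] [MeasurableSpace W] [BorelSpace W] [SecondCountableTopology W]
  {i : H →L[ℝ] W} {μ : Measure W}

theorem measurableSet_le_combination {Ω : Type*} [MeasurableSpace Ω] {a b c : Ω → EReal}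
    (ha : Measurable a) (hb : Measurable b) (hc : Measurable c) (α : ℝ) :
    MeasurableSet {x | c x ≤ (α : EReal) * a x + ((1 - α : ℝ) : EReal) * b x} :=
  measurableSet_le hc ((ha.const_mul _).add (hb.const_mul _))

theorem IsHConvex.ae_aeConvex (hμ : IsAbstractWienerSpace i μ) {F G : W → EReal}
    (hF : IsHConvex i μ F) (hG : Measurable G) (hFG : F =ᵐ[μ] G) {e : ℕ → StrongDual ℝ W} {n : ℕ}
    (he : Orthonormal ℝ fun j : Fin n => dualToH i (e j)) :
    ∀ᵐ w ∂μ, AEConvex volume fun x : Fin n → ℝ => G (replaceCoords i e n (w, x)) := by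
  have := hμ.isProbabilityMeasure
  have hP := quasiMeasurePreserving_replaceCoords hμ he
  have hT : ∀ y : Fin n → ℝ, MeasurePreserving (fun z : W × (Fin n → ℝ) => (z.1, z.2 + y))
      (μ.prod volume) (μ.prod volume) := fun y =>
    (MeasurePreserving.id μ).prod (measurePreserving_add_right volume y)
  unfold AEConvex
  simp only [eventually_all, ae_all_iff]
  intro q hq0 hq1
  have hq : (q : ℝ) ∈ Icc (0 : ℝ) 1 := ⟨by exact_mod_cast hq0.le, by exact_mod_cast hq1.le⟩
  have h1 : ∀ y : Fin n → ℝ, ∀ᵐ z ∂(μ.prod (volume : Measure (Fin n → ℝ))),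
      G (replaceCoords i e n (z.1, z.2 + (1 - (q : ℝ)) • y))
        ≤ ((q : ℝ) : EReal) * G (replaceCoords i e n z)
          + ((1 - (q : ℝ) : ℝ) : EReal) * G (replaceCoords i e n (z.1, z.2 + y)) := by
    intro y
    have hFP := hP.ae hFG
    filter_upwards [hP.ae (hF 0 (∑ j : Fin n, y j • dualToH i (e j)) q hq), hFP,
      (hT y).quasiMeasurePreserving.ae hFP,
      (hT ((1 - (q : ℝ)) • y)).quasiMeasurePreserving.ae hFP] with z hz e1 e2 e3
    rw [← e1, ← e2, ← e3, replaceCoords_add, replaceCoords_add, spanPoint_smul, spanPoint_eq]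
    simpa using hz
  have h2 : MeasurableSet {s : (Fin n → ℝ) × (W × (Fin n → ℝ)) |
      G (replaceCoords i e n (s.2.1, s.2.2 + (1 - (q : ℝ)) • s.1))
        ≤ ((q : ℝ) : EReal) * G (replaceCoords i e n s.2)
          + ((1 - (q : ℝ) : ℝ) : EReal) * G (replaceCoords i e n (s.2.1, s.2.2 + s.1))} := by
    have hc := (continuous_replaceCoords i e n).measurable
    refine measurableSet_le_combination (hG.comp (hc.comp ?_)) (hG.comp (hc.comp ?_))
      (hG.comp (hc.comp ?_)) _ <;> fun_prop
  -- The null set in `h1` depends on the increment `y`. Fubini, applicable to the Borel version `G`,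
  -- makes almost all `y` valid for almost every `(w, x)`; the increment then becomes a second point
  -- through `y - x`.
  have h3 := (Measure.ae_ae_comm (μ := (volume : Measure (Fin n → ℝ)))
    (ν := μ.prod (volume : Measure (Fin n → ℝ))) h2).1 (Eventually.of_forall h1)
  filter_upwards [Measure.ae_ae_of_ae_prod h3] with w hw
  filter_upwards [hw] with x hx
  filter_upwards [(measurePreserving_sub_right volume x).quasiMeasurePreserving.ae hx] with y hy
  rw [add_sub_cancel] at hy
  rwa [show (q : ℝ) • x + (1 - (q : ℝ)) • y = x + (1 - (q : ℝ)) • (y - x) by module]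

theorem IsHConvex.isCConvex (hμ : IsAbstractWienerSpace i μ) {F : W → EReal}
    (hF : IsHConvex i μ F) (hFm : AEMeasurable F μ) (hF_bot : ∀ w, F w ≠ ⊥) :
    IsCConvex i μ F := by
  intro N e he n hn
  have := hμ.isProbabilityMeasure
  have horth := he.orthonormal_fin hn
  obtain ⟨G, hG, hFG⟩ := hFm
  have hP := quasiMeasurePreserving_replaceCoords hμ horth
  have hc := (continuous_replaceCoords i e n).measurable
  filter_upwards [hF.ae_aeConvex hμ hG hFG horth, Measure.ae_ae_of_ae_prod (hP.ae hFG)]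
    with w hw hw'
  obtain ⟨g, hg, hGg⟩ := hw.exists_isConvexFun (hG.comp (hc.comp measurable_prodMk_left))
    (hw'.mono fun x hx => by rw [← hx]; exact hF_bot _)
  refine ⟨g, hg, ?_⟩
  filter_upwards [hw', hGg] with x hx hx'
  exact hx.trans hx'

theorem ae_iff_combination (hμ : IsAbstractWienerSpace i μ) {F G : W → EReal} (hFG : F =ᵐ[μ] G)
    (h : H) (α : ℝ) :
    ∀ᵐ w ∂μ, F (w + i (α • h)) ≤ (α : EReal) * F (w + i h) + ((1 - α : ℝ) : EReal) * F w ↔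
      G (w + i (α • h)) ≤ (α : EReal) * G (w + i h) + ((1 - α : ℝ) : EReal) * G w := by
  filter_upwards [hFG, (quasiMeasurePreserving_shift hμ h).ae hFG,
    (quasiMeasurePreserving_shift hμ (α • h)).ae hFG] with w h1 h2 h3
  rw [h1, h2, h3]

theorem IsCConvex.ae_le_of_unit [TopologicalSpace.SeparableSpace H]
    (hμ : IsAbstractWienerSpace i μ) {F : W → EReal}
    (hF : IsCConvex i μ F) (hFm : AEMeasurable F μ) {φ : StrongDual ℝ W} (hφ : ‖dualToH i φ‖ = 1)
    (t : ℝ) {α : ℝ} (hα : α ∈ Icc (0 : ℝ) 1) :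
    ∀ᵐ w ∂μ, F (w + i (α • t • dualToH i φ))
      ≤ (α : EReal) * F (w + i (t • dualToH i φ)) + ((1 - α : ℝ) : EReal) * F w := by
  have := hμ.isProbabilityMeasure
  obtain ⟨N, e, he, he0, hN⟩ := exists_isBasisInDual (denseRange_dualToH i hμ.injective) hφ
  have hN' : ((1 : ℕ) : ℕ∞) ≤ N := by exact_mod_cast hN
  have horth := he.orthonormal_fin hN'
  obtain ⟨G, hG, hFG⟩ := hFm
  have hiff := ae_iff_combination hμ hFG (t • dualToH i φ) α
  suffices h : ∀ᵐ w ∂μ, G (w + i (α • t • dualToH i φ))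
      ≤ (α : EReal) * G (w + i (t • dualToH i φ)) + ((1 - α : ℝ) : EReal) * G w by
    filter_upwards [h, hiff] with w h1 h2 using h2.2 h1
  refine ae_of_ae_replaceCoords hμ horth ?_ ?_
  · refine measurableSet_le_combination (hG.comp ?_) hG (hG.comp ?_) _ <;> fun_prop
  have hP := quasiMeasurePreserving_replaceCoords hμ horth
  filter_upwards [hF N e he 1 hN', Measure.ae_ae_of_ae_prod (hP.ae hiff)] with w hw hw'
  obtain ⟨g, hg, hFg⟩ := hw
  change ∀ᵐ x : Fin 1 → ℝ, F (replaceCoords i e 1 (w, x)) = g x at hFg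
  set y : Fin 1 → ℝ := fun _ => t with hy
  have hsy : spanPoint i e 1 y = i (t • dualToH i φ) := by simp [spanPoint, hy, he0]
  filter_upwards [hFg, hw', (measurePreserving_add_right volume y).quasiMeasurePreserving.ae hFg,
    (measurePreserving_add_right volume (α • y)).quasiMeasurePreserving.ae hFg] with x h1 h2 h3 h4
  refine h2.1 ?_
  rw [replaceCoords_add, spanPoint_smul, hsy] at h4
  rw [replaceCoords_add, hsy] at h3
  rw [map_smul, h4, h3, h1, show x + α • y = α • (x + y) + (1 - α) • x by module]
  exact hg.2 _ _ α hα

theorem IsCConvex.ae_le_of_dual [TopologicalSpace.SeparableSpace H]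
    (hμ : IsAbstractWienerSpace i μ) {F : W → EReal}
    (hF : IsCConvex i μ F) (hFm : AEMeasurable F μ) (φ : StrongDual ℝ W)
    {α : ℝ} (hα : α ∈ Icc (0 : ℝ) 1) :
    ∀ᵐ w ∂μ, F (w + i (α • dualToH i φ))
      ≤ (α : EReal) * F (w + i (dualToH i φ)) + ((1 - α : ℝ) : EReal) * F w := by
  by_cases h0 : dualToH i φ = 0
  · refine Eventually.of_forall fun w => ?_
    simp only [h0, smul_zero, map_zero, add_zero]
    exact self_le_combination hα _
  · have hn : ‖dualToH i φ‖ ≠ 0 := norm_ne_zero_iff.2 h0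
    have hsm : dualToH i (‖dualToH i φ‖⁻¹ • φ) = ‖dualToH i φ‖⁻¹ • dualToH i φ := by
      simp only [← dualToHₗ_apply, map_smul]
    have he : ‖dualToH i (‖dualToH i φ‖⁻¹ • φ)‖ = 1 := by
      rw [hsm, norm_smul, norm_inv, norm_norm, inv_mul_cancel₀ hn]
    have := hF.ae_le_of_unit hμ hFm he ‖dualToH i φ‖ hα
    rwa [hsm, smul_smul ‖dualToH i φ‖, mul_inv_cancel₀ hn, one_smul] at this

/-- Values of `F` at the approximating translates need not converge, so the limit is taken on level
sets: a violation at `h` separated by rational levels is, up to a null set, a discrepancy between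
`h` and `hs m` in `S` or `T`, and these have vanishing measure. -/
theorem IsCConvex.ae_le [TopologicalSpace.SeparableSpace H]
    (hμ : IsAbstractWienerSpace i μ) {F : W → EReal}
    (hF : IsCConvex i μ F) (hFm : AEMeasurable F μ) (hF_bot : ∀ w, F w ≠ ⊥) (h : H)
    {α : ℝ} (hα : α ∈ Ioo (0 : ℝ) 1) :
    ∀ᵐ w ∂μ, F (w + i (α • h)) ≤ (α : EReal) * F (w + i h) + ((1 - α : ℝ) : EReal) * F w := by
  have := hμ.isProbabilityMeasure
  obtain ⟨hs, hs1, hs2⟩ := mem_closure_iff_seq_limit.1 (denseRange_dualToH i hμ.injective h)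
  choose φ hφ using hs1
  have hm := fun m => hF.ae_le_of_dual hμ hFm (φ m) (Ioo_subset_Icc_self hα)
  simp only [hφ] at hm
  obtain ⟨G, hG, hFG⟩ := hFm
  have hGm : ∀ m, ∀ᵐ w ∂μ, G (w + i (α • hs m))
      ≤ (α : EReal) * G (w + i (hs m)) + ((1 - α : ℝ) : EReal) * G w := fun m => by
    filter_upwards [hm m, ae_iff_combination hμ hFG (hs m) α] with w h1 h2 using h2.1 h1
  have key : ∀ᵐ w ∂μ, ∀ A B : ℚ, G (w + i h) < ((A : ℝ) : EReal) → G w < ((B : ℝ) : EReal) →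
      G (w + i (α • h)) ≤ ((α * A + (1 - α) * B : ℝ) : EReal) := by
    simp only [ae_all_iff]
    intro A B
    set c : EReal := ((α * A + (1 - α) * B : ℝ) : EReal) with hc
    set S : Set W := {w | G w < ((A : ℝ) : EReal)} with hS
    set T : Set W := {w | c < G w} with hT
    have hSm : MeasurableSet S := measurableSet_lt hG measurable_const
    have hTm : MeasurableSet T := measurableSet_lt measurable_const hG
    have hlim : Tendsto (fun m => μ {w | w + i h ∈ S ∧ w + i (hs m) ∉ S} +
        μ {w | w + i (α • h) ∈ T ∧ w + i (α • hs m) ∉ T}) atTop (𝓝 (0 + 0)) :=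
      (tendsto_measure_shift hμ hSm hs2).add (tendsto_measure_shift hμ hTm (hs2.const_smul α))
    rw [add_zero] at hlim
    suffices h0 : μ {w | w + i h ∈ S ∧ G w < ((B : ℝ) : EReal) ∧ w + i (α • h) ∈ T} = 0 by
      filter_upwards [compl_mem_ae_iff.2 h0] with w hw h1 h2
      by_contra h3
      exact hw ⟨h1, h2, not_le.1 h3⟩
    refine le_antisymm (ge_of_tendsto' hlim fun m => ?_) zero_le
    refine le_trans (measure_mono_ae ?_) (measure_union_le _ _)
    filter_upwards [hGm m] with w hw hw'
    obtain ⟨h1, h2, h3⟩ := hw'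
    by_cases h4 : w + i (hs m) ∈ S
    · refine Or.inr ⟨h3, fun h5 => ?_⟩
      exact absurd (hw.trans (combination_le_coe (Ioo_subset_Icc_self hα) h4.le h2.le))
        (not_le.2 h5)
    · exact Or.inl ⟨h1, h4⟩
  filter_upwards [key, hFG, (quasiMeasurePreserving_shift hμ h).ae hFG,
    (quasiMeasurePreserving_shift hμ (α • h)).ae hFG] with w h1 h2 h3 h4
  rw [← h2, ← h3, ← h4] at h1
  exact le_combination hα (hF_bot _) (hF_bot _) h1

theorem IsCConvex.isHConvex [TopologicalSpace.SeparableSpace H]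
    (hμ : IsAbstractWienerSpace i μ) {F : W → EReal}
    (hF : IsCConvex i μ F) (hFm : AEMeasurable F μ) (hF_bot : ∀ w, F w ≠ ⊥) :
    IsHConvex i μ F := by
  intro h k α hα
  by_cases h01 : α = 0 ∨ α = 1
  · refine Eventually.of_forall fun w => ?_
    have := combination_zero_one_le h01 F (w + i h) (w + i k)
    rwa [show α • (w + i h) + (1 - α) • (w + i k) = w + α • i h + (1 - α) • i k by module] at this
  rw [not_or] at h01
  have hα' : α ∈ Ioo (0 : ℝ) 1 :=
    ⟨lt_of_le_of_ne hα.1 (Ne.symm h01.1), lt_of_le_of_ne hα.2 h01.2⟩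
  -- Translating the base point by `k` reduces the pair `h`, `k` to the single direction `h - k`.
  filter_upwards [(quasiMeasurePreserving_shift hμ k).ae
    (hF.ae_le hμ hFm hF_bot (h - k) hα')] with w hw
  rwa [map_smul, map_sub, show w + i k + α • (i h - i k) = w + α • i h + (1 - α) • i k by module,
    show w + i k + (i h - i k) = w + i h by abel] at hw

end Equivalence

end WienerConvexity

theorem mainTheorem2 {H W : Type*}
    [NormedAddCommGroup H] [InnerProductSpace ℝ H] [CompleteSpace H]
    [TopologicalSpace.SeparableSpace H]
    [AddCommGroup W] [Module ℝ W] [UniformSpace W] [IsUniformAddGroup W] [ContinuousSMul ℝ W]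
    [LocallyConvexSpace ℝ W] [CompleteSpace W] [(uniformity W).IsCountablyGenerated] [T2Space W]
    [MeasurableSpace W] [BorelSpace W]
    (i : H →L[ℝ] W) (μ : Measure W) (hμ : WienerConvexity.IsAbstractWienerSpace i μ)
    (F : W → EReal) (hF : AEMeasurable F μ) (hF_bot : ∀ w, F w ≠ ⊥) :
    WienerConvexity.IsHConvex i μ F ↔ WienerConvexity.IsCConvex i μ F := by
  have : TopologicalSpace.SeparableSpace W := hμ.denseRange.separableSpace i.continuous
  have : SecondCountableTopology W := UniformSpace.secondCountable_of_separable W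
  exact ⟨fun h => h.isCConvex hμ hF hF_bot, fun h => h.isHConvex hμ hF hF_bot⟩
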